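/- Let $X\subset\mathbb R^2$ be compact (for instance a convex polygon), let $K:X\times X\to\mathbb R$ be a continuous positive semidefinite kernel with reproducing kernel Hilbert space $\mathcal H$, and let $\mu\in\mathcal H$. Let $\mathcal P$ be a set of Borel probability densities on $X$ (with respect to Lebesgue measure) that are nondegenerate, i.e. give positive mass to every nonempty relatively open subset of $X$; let $\mathrm{co}\,\mathcal P$ be its convex hull, and for a density $p$ write $\|f\|_p^2=\int_X f(a)^2p(a)\,da$ and $L_p[f](x)=\int_X K(x,a)f(a)p(a)\,da$, a compact positive self-adjoint operator on $\mathbb L^2_p$. The norm $\|L_p^{-r}\mu\|_p$ is the least norm of a $g\in\mathbb L^2_p$ with $L_p^{r}g=\mu$, and $\infty$ if there is no such $g$. Measurements $y_i=\mu(x_i)+\nu_i$, $i=1,2,\dots$, are taken, where $x_i\in X$ is a random location drawn from a density $p_i\in\mathcal P$ that may vary with time in an arbitrary way and may itself be random (so that $\Pr[x_i\in B]=\mathbb E\int_B p_i(a)\,da$ for all Borel sets $B\subset X$), and where $\nu_t\sim\mathcal N(0,\sigma^2)$ is independent of $(x_1,\dots,x_t,\nu_1,\dots,\nu_{t-1})$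 for every $t$. Assume: 1. (Covariance decay) For every $q<\infty$ there is a constant $\mathcal A_1<\infty$ such that for all measurable $f_1,f_2:X\to\mathbb R$ with $\|f_1\|_p<q$ and $\|f_2\|_p<q$ for all $p\in\mathrm{co}\,\mathcal P$, all instants $i$ and all $n\ge 0$, $$\Big|\sum_{k=0}^{n}\mathrm{Cov}\big(f_1(x_i)+f_2(x_i)\nu_i,\ f_1(x_{i+k})\big)\Big|<\mathcal A_1 .$$ (This holds in particular if $\sum_{k=0}^\infty|\mathrm{Cov}(f_1(x_i)+f_2(x_i)\nu_i,f_1(x_{i+k}))|<\mathcal A_1$ for all these $f_1,f_2$ and $i$.) 2. (Smoothness) For some $r$ with $\frac12<r\le 1$, $\ \sup_{p\in\mathrm{co}\,\mathcal P}\|L_p^{-r}\mu\|_p<\infty$. Let $\gamma_t=c\,t^{-\alpha}$ with $c>0$ and $0<\alpha<\frac12$. Then for every $t\ge1$ the functional $$J_t(f)=\frac1t\sum_{i=1}^t\big(y_i-f(x_i)\big)^2+\gamma_t\|f\|_{\mathcal H}^2,\qquad f\in\mathcal H,$$ has a unique minimizer $\hat\mu_t$, and as $t\to\infty$ $$\|\hat\mu_t-\mu\|_{\mathcal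 H}\longrightarrow 0\quad\text{and}\quad \sup_{x\in X}|\hat\mu_t(x)-\mu(x)|\longrightarrow 0\qquad\text{in probability.}$$ -/

import Mathlib

open MeasureTheory ProbabilityTheory Filter Topology Set
open scoped ENNReal NNReal

namespace RKHSConsistency

/-- The plane. -/
abbrev Plane := EuclideanSpace ℝ (Fin 2)

noncomputable section

variable {X : Set Plane}

/-- Lebesgue measure `da` on the domain `X`. -/
def lebesgueOn (X : Set Plane) : Measure X := (volume : Measure Plane).comap Subtype.val

/-- The measure `p(a) da` on the domain `X`, where `da` is Lebesgue measure on `X`. -/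
def densityMeasure (p : X → ℝ) : Measure X :=
  (lebesgueOn X).withDensity fun a => ENNReal.ofReal (p a)

/-- `p` is a Borel nondegenerate probability density on `X`: a nonnegative Borel function of
integral one that charges every nonempty (relatively) open subset of `X`. -/
structure IsNondegenerateDensity (p : X → ℝ) : Prop where
  measurable : Measurable p
  nonneg : ∀ a, 0 ≤ p a
  lintegral_eq_one : ∫⁻ a, ENNReal.ofReal (p a) ∂(lebesgueOn X) = 1
  pos_of_isOpen : ∀ U : Set X, IsOpen U → U.Nonempty → 0 < densityMeasure p U

/-- The seminorm `‖f‖_p = (∫ f(a)² p(a) da)^(1/2)`, with value `∞` if `f` is not in `L²_p`. -/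
def normP (p f : X → ℝ) : ℝ≥0∞ := eLpNorm f 2 (densityMeasure p)

/-- The integral operator `L_p[f](x) = ∫ K(x,a) f(a) p(a) da`. -/
def integralOp (K : X → X → ℝ) (p f : X → ℝ) : X → ℝ :=
  fun x => ∫ a, K x a * f a ∂(densityMeasure p)

/-- `L_p^r g = u` in `L²_p`. For a continuous kernel on a compact domain `L_p` is a compact
positive self-adjoint operator on `L²_p`, so that its eigenvectors (those of eigenvalue zero
included) span a dense subspace; `L_p^r g` is the element whose coefficient along an eigenvector
of eigenvalue `l` is `l ^ r` times that of `g`. -/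
def IsPowImage (K : X → X → ℝ) (p : X → ℝ) (r : ℝ) (g : Lp ℝ 2 (densityMeasure p))
    (u : X → ℝ) : Prop :=
  ∀ (l : ℝ) (φ : Lp ℝ 2 (densityMeasure p)),
    integralOp K p φ =ᵐ[densityMeasure p] (fun x => l * φ x) →
      ∫ a, φ a * u a ∂(densityMeasure p) = l ^ r * ∫ a, φ a * g a ∂(densityMeasure p)

/-- `‖L_p^{-r} u‖_p`: the least `L²_p` norm of a `g` with `L_p^r g = u` (there is only one such
`g` orthogonal to the kernel of `L_p`, and it has the least norm), and `∞` if `u` is not in the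
range of `L_p^r`. -/
def negPowNorm (K : X → X → ℝ) (p : X → ℝ) (r : ℝ) (u : X → ℝ) : ℝ≥0∞ :=
  ⨅ (g : Lp ℝ 2 (densityMeasure p)) (_ : IsPowImage K p r g u), normP p g

/-- Smoothness of the target: `sup_{p ∈ co 𝒟} ‖L_p^{-r} u‖_p < ∞`. -/
def SourceCondition (K : X → X → ℝ) (𝒟 : Set (X → ℝ)) (r : ℝ) (u : X → ℝ) : Prop :=
  (⨆ p ∈ convexHull ℝ 𝒟, negPowNorm K p r u) < ⊤

/-- Decay of the covariances: for every `q` there is a constant `A`, not depending on the functions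
`f₁, f₂` with `‖f₁‖_p, ‖f₂‖_p < q` for all `p ∈ co 𝒟` nor on the instant `i`, that bounds the series
`∑_k Cov(f₁(x_i) + f₂(x_i) ν_i, f₁(x_{i+k}))` (all its partial sums) in absolute value. -/
def CovarianceDecay {Ω : Type*} [MeasurableSpace Ω] (P : Measure Ω) (𝒟 : Set (X → ℝ))
    (x : ℕ → Ω → X) (ν : ℕ → Ω → ℝ) : Prop :=
  ∀ q : ℝ, ∃ A : ℝ, ∀ f₁ f₂ : X → ℝ, Measurable f₁ → Measurable f₂ →
    (∀ p ∈ convexHull ℝ 𝒟, normP p f₁ < ENNReal.ofReal q ∧ normP p f₂ < ENNReal.ofReal q) →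
      ∀ i n : ℕ, |∑ k ∈ Finset.range (n + 1),
        cov[fun ω => f₁ (x i ω) + f₂ (x i ω) * ν i ω, fun ω => f₁ (x (i + k) ω); P]| < A

/-- `x i` is drawn from the (possibly random) density `p i`, which takes values in `𝒟`: the
probability of `x i ∈ B` is the expectation of `∫_B p i`. This is the case if `p i` is a fixed
density of `x i`, and also if `p i` is the conditional density of `x i` given the past. -/
structure IsDrawnFrom {Ω : Type*} [MeasurableSpace Ω] (P : Measure Ω) (𝒟 : Set (X → ℝ))
    (x : ℕ → Ω → X) (p : ℕ → Ω → X → ℝ) : Prop where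
  measurable : ∀ i, Measurable (x i)
  measurable_density : ∀ i, Measurable (Function.uncurry (p i))
  density_mem : ∀ i ω, p i ω ∈ 𝒟
  law : ∀ i (B : Set X), MeasurableSet B →
    P (x i ⁻¹' B) = ∫⁻ ω, densityMeasure (p i ω) B ∂P

/-- The noise: each `ν t` is `N(0, σ²)` and independent of the locations up to and including
instant `t` and of the earlier noises, jointly. -/
structure IsMeasurementNoise {Ω : Type*} [MeasurableSpace Ω] (P : Measure Ω)
    (x : ℕ → Ω → X) (ν : ℕ → Ω → ℝ) (σ : ℝ≥0) : Prop where
  measurable : ∀ t, Measurable (ν t)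
  law : ∀ t, P.map (ν t) = gaussianReal 0 (σ ^ 2)
  indep : ∀ t, IndepFun (ν t)
    (fun ω => ((fun i : Fin (t + 1) => x i ω), (fun i : Fin t => ν i ω))) P

variable {H : Type*} [NormedAddCommGroup H] [InnerProductSpace ℝ H] [RKHS ℝ H X ℝ]

/-- The Tikhonov functional `J(f) = (1/t) ∑ (y_i - f(x_i))² + γ ‖f‖²` of the first `t` data. -/
def tikhonovFunctional (γ : ℝ) (t : ℕ) (x : ℕ → X) (y : ℕ → ℝ) (f : H) : ℝ :=
  (∑ i ∈ Finset.range t, (y i - f (x i)) ^ 2) / t + γ * ‖f‖ ^ 2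

variable (H) in
/-- The Tikhonov estimate: a minimizer of the Tikhonov functional over `H`. -/
def tikhonovEstimate (γ : ℝ) (t : ℕ) (x : ℕ → X) (y : ℕ → ℝ) : H :=
  Classical.epsilon fun f : H => IsMinOn (tikhonovFunctional γ t x y) univ f

end

end RKHSConsistency

/-! Write `d` for the error of the minimizer. Comparing the functional at the minimizer and at `μ`
(`basic_inequality`) bounds the empirical second moment of `d` plus `γ ‖d‖²` by a noise term minus
`2γ ⟨μ, d⟩`, so the task is to absorb `⟨μ, d⟩`.

The source condition is used in a dual form (`two_inner_le_of_negPowNorm_lt`): `2⟨μ, w⟩ ≤ ‖w‖² +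
‖w‖²_p / s + s^(2r-1) B²` for all `w` and `s > 0`. This is affine in the sampling measure, so it
survives averaging over random densities and over time, and no power of an averaged operator is
needed. With `w = -d/2` and `s` small but fixed, the last term is negligible.

A law of large numbers, uniform over the unit ball of `H`
(`tendsto_measure_exists_lt_abs_meanDeviation`), replaces the expected second moment of `d` by the
empirical one, which the left side absorbs once `γ ≤ 2s`. As `s` is fixed, no rate is needed there.
The noise terms are uncorrelated in `H`, so their average is of order `t^(-1/2)` in probability
(`measure_le_norm_noise_le`), which is `o(γ)` because `α < 1/2`. `norm_error_lt` combines these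
bounds pointwise in `ω`; boundedness of the kernel then gives the sup-norm. -/

namespace RKHSConsistency

/-! ### The feature map of the reproducing kernel Hilbert space. -/

section KernelSection

variable {X H : Type*} [NormedAddCommGroup H] [InnerProductSpace ℝ H] [CompleteSpace H]
  [RKHS ℝ H X ℝ]

variable (H) in
/-- The kernel section `K(a, ·)` as an element of the reproducing kernel Hilbert space. -/
noncomputable def kernelSection (a : X) : H := RKHS.kerFun H a (1 : ℝ)

theorem inner_kernelSection (f : H) (a : X) : inner ℝ f (kernelSection H a) = f a := by
  simp [kernelSection]

theorem kernelSection_inner (f : H) (a : X) : inner ℝ (kernelSection H a) f = f a := by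
  rw [real_inner_comm, inner_kernelSection]

theorem kernelSection_apply (a b : X) : kernelSection H a b = RKHS.kernel H b a 1 :=
  RKHS.kerFun_apply H a 1 b

theorem coe_sum {ι : Type*} (s : Finset ι) (f : ι → H) (a : X) :
    (∑ i ∈ s, f i : H) a = ∑ i ∈ s, f i a := by
  simp only [← inner_kernelSection, sum_inner]

theorem abs_apply_le {κ : ℝ} (hκ : ∀ a : X, ‖kernelSection H a‖ ≤ κ) (f : H) (a : X) :
    |f a| ≤ κ * ‖f‖ := by
  rw [← inner_kernelSection, mul_comm]
  exact (abs_real_inner_le_norm _ _).trans (by gcongr; exact hκ a)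

theorem abs_apply_sub_le (f : H) (a b : X) :
    |f a - f b| ≤ ‖f‖ * ‖kernelSection H a - kernelSection H b‖ := by
  rw [← inner_kernelSection, ← inner_kernelSection, ← inner_sub_right]
  exact abs_real_inner_le_norm _ _

variable [TopologicalSpace X]

/-- By the reproducing property the squared distance between two sections is `K a a - 2 K a b + K b
b`, so continuity of the kernel passes to the feature map. -/
theorem continuous_kernelSection {K : X → X → ℝ} (hK : Continuous (Function.uncurry K))
    (hHK : ∀ a b : X, RKHS.kernel H a b 1 = K a b) :
    Continuous fun a : X => kernelSection H a := by
  rw [continuous_iff_continuousAt]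
  intro b
  rw [ContinuousAt, tendsto_iff_norm_sub_tendsto_zero]
  have key : ∀ a, ‖kernelSection H a - kernelSection H b‖ =
      √(K a a - 2 * K a b + K b b) := by
    intro a
    rw [← Real.sqrt_sq (norm_nonneg _), norm_sub_sq_real, ← real_inner_self_eq_norm_sq,
      ← real_inner_self_eq_norm_sq]
    simp only [kernelSection_inner, kernelSection_apply, hHK]
  simp only [key]
  have h0 : √(K b b - 2 * K b b + K b b) = 0 := by
    rw [show K b b - 2 * K b b + K b b = 0 by ring, Real.sqrt_zero]
  rw [← h0]
  refine Tendsto.sqrt ?_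
  have h1 : Continuous fun a => K a a := hK.comp (continuous_id.prodMk continuous_id)
  have h2 : Continuous fun a => K a b := hK.comp (continuous_id.prodMk continuous_const)
  exact ((h1.sub (continuous_const.mul h2)).add continuous_const).tendsto b

theorem continuous_coe (hk : Continuous fun a : X => kernelSection H a) (f : H) :
    Continuous f := by
  have : (f : X → ℝ) = fun a => inner ℝ f (kernelSection H a) := by
    ext a; rw [inner_kernelSection]
  rw [this]
  exact continuous_const.inner hk

theorem exists_norm_kernelSection_le [CompactSpace X]
    (hk : Continuous fun a : X => kernelSection H a) :
    ∃ κ : ℝ, 1 ≤ κ ∧ ∀ a : X, ‖kernelSection H a‖ ≤ κ := by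
  obtain ⟨κ, hκ⟩ := (isCompact_range hk).isBounded.exists_norm_le
  exact ⟨max κ 1, le_max_right _ _, fun a => (hκ _ (mem_range_self a)).trans (le_max_left _ _)⟩

end KernelSection

/-! ### The covariance operator of a sampling measure. -/

section CovarianceOperator

variable {X H : Type*} [TopologicalSpace X] [CompactSpace X] [MeasurableSpace X] [BorelSpace X]
  [NormedAddCommGroup H] [InnerProductSpace ℝ H] [CompleteSpace H] [RKHS ℝ H X ℝ]

theorem _root_.Continuous.integrable_of_compactSpace {E : Type*} [NormedAddCommGroup E]
    {π : Measure X} [IsFiniteMeasure π] {f : X → E} (hf : Continuous f) : Integrable f π :=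
  hf.integrable_of_hasCompactSupport (HasCompactSupport.of_compactSpace f)

variable (H) in
/-- The covariance operator `∫ K_a ⊗ K_a dπ(a)` of the measure `π` on the Hilbert space. -/
noncomputable def covOperator (π : Measure X) : H →L[ℝ] H :=
  ∫ a, InnerProductSpace.rankOne ℝ (kernelSection H a) (kernelSection H a) ∂π

variable {π : Measure X} [IsProbabilityMeasure π]

omit [CompactSpace X] [MeasurableSpace X] [BorelSpace X] in
theorem continuous_rankOne_kernelSection (hk : Continuous fun a : X => kernelSection H a) :
    Continuous fun a : X =>
      InnerProductSpace.rankOne ℝ (kernelSection H a) (kernelSection H a) :=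
  ((InnerProductSpace.rankOne ℝ).continuous.comp hk).clm_apply hk

theorem inner_covOperator (hk : Continuous fun a : X => kernelSection H a) (f g : H) :
    inner ℝ (covOperator H π f) g = ∫ a, f a * g a ∂π := by
  have hi : Integrable (fun a : X =>
      InnerProductSpace.rankOne ℝ (kernelSection H a) (kernelSection H a)) π :=
    (continuous_rankOne_kernelSection hk).integrable_of_compactSpace
  rw [covOperator, ContinuousLinearMap.integral_apply hi, real_inner_comm, ← integral_inner]
  · simp [kernelSection_inner, inner_smul_right, inner_kernelSection]
  · exact hi.apply_continuousLinearMap f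

/-- The compact operators form a closed convex set, and the operator is an average of rank-one ones.
-/
theorem isCompactOperator_covOperator (hk : Continuous fun a : X => kernelSection H a) :
    IsCompactOperator (covOperator H π) := by
  have hmem : covOperator H π ∈ (compactOperator (RingHom.id ℝ) H H : Set (H →L[ℝ] H)) := by
    refine Convex.integral_mem (Submodule.convex _) ?_ (Eventually.of_forall fun a => ?_)
      (continuous_rankOne_kernelSection hk).integrable_of_compactSpace
    · exact isClosed_setOfPred_isCompactOperator
    · have h : IsCompactOperator (ContinuousLinearMap.toSpanSingleton ℝ (kernelSection H a)) :=
        isCompactOperator_of_locallyCompactSpace_rng _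
      exact h.comp_clm (innerSL ℝ (kernelSection H a))
  exact hmem

theorem isSymmetric_covOperator (hk : Continuous fun a : X => kernelSection H a) :
    (covOperator H π : H →ₗ[ℝ] H).IsSymmetric := by
  intro f g
  change inner ℝ (covOperator H π f) g = inner ℝ f (covOperator H π g)
  rw [real_inner_comm _ f, inner_covOperator hk, inner_covOperator hk]
  simp only [mul_comm]

/-- This is where nondegeneracy enters: elements of `H` are continuous, so a nonzero one is nonzero
on an open set. It makes all eigenvalues of the covariance operator positive, so that `l ^ (r - 1)`
is meaningful. -/
theorem integral_sq_pos (hk : Continuous fun a : X => kernelSection H a)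
    (hπ : ∀ U : Set X, IsOpen U → U.Nonempty → 0 < π U) {w : H} (hw : w ≠ 0) :
    0 < ∫ a, w a * w a ∂π := by
  have : π.IsOpenPosMeasure := ⟨fun U hU hne => (hπ U hU hne).ne'⟩
  have hc : Continuous fun a => w a * w a := (continuous_coe hk w).mul (continuous_coe hk w)
  obtain ⟨a, ha⟩ : ∃ a, w a ≠ 0 := by
    by_contra! h
    exact hw (RKHS.ext fun a => by simpa using h a)
  exact hc.integral_pos_of_hasCompactSupport_nonneg_nonzero (HasCompactSupport.of_compactSpace _)
    (fun a => mul_self_nonneg _) (mul_self_ne_zero.2 ha)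

theorem rpow_le_one_add {x θ : ℝ} (hx : 0 ≤ x) (h0 : 0 ≤ θ) (h1 : θ ≤ 1) : x ^ θ ≤ 1 + x := by
  rcases le_total x 1 with h | h
  · exact (Real.rpow_le_one hx h h0).trans (by linarith)
  · exact ((Real.rpow_le_rpow_of_exponent_le h h1).trans_eq (Real.rpow_one x)).trans (by linarith)

end CovarianceOperator

/-! ### The dual form of the source condition, by spectral decomposition. -/

section SpectralInequality

variable {X H : Type*} [TopologicalSpace X] [CompactSpace X] [MeasurableSpace X] [BorelSpace X]
  [NormedAddCommGroup H] [InnerProductSpace ℝ H] [CompleteSpace H] [RKHS ℝ H X ℝ]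
  {π : Measure X} [IsProbabilityMeasure π]

theorem memLp_coe (hk : Continuous fun a : X => kernelSection H a) (w : H) : MemLp w 2 π :=
  (continuous_coe hk w).memLp_of_hasCompactSupport (HasCompactSupport.of_compactSpace _)

/-- The inequality for finite sums of eigenvectors of the covariance operator. -/
theorem two_inner_le_of_mem_iSup_eigenspace (hk : Continuous fun a : X => kernelSection H a)
    (hπ : ∀ U : Set X, IsOpen U → U.Nonempty → 0 < π U) {g : X → ℝ} (hg : MemLp g 2 π)
    {r : ℝ} (hr : 1 / 2 < r) (hr' : r ≤ 1) {μ : H}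
    (hμ : ∀ (l : ℝ) (u : H), covOperator H π u = l • u →
      ∫ a, u a * μ a ∂π = l ^ r * ∫ a, u a * g a ∂π)
    {s : ℝ} (hs : 0 < s) {w : H}
    (hw : w ∈ ⨆ l, Module.End.eigenspace (covOperator H π : Module.End ℝ H) l) :
    2 * inner ℝ μ w ≤ ‖w‖ ^ 2 + inner ℝ (covOperator H π w) w / s +
      s ^ (2 * r - 1) * ∫ a, g a * g a ∂π := by
  classical
  set C := covOperator H π with hC
  obtain ⟨v, hv, rfl⟩ := (Submodule.mem_iSup_iff_exists_finsupp _ _).1 hw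
  have hCv : ∀ l, C (v l) = l • v l := fun l => Module.End.mem_eigenspace_iff.1 (hv l)
  have horth : ∀ l m, l ≠ m → inner ℝ (v l) (v m) = 0 := fun l m hlm =>
    (isSymmetric_covOperator (π := π) hk).orthogonalFamily_eigenspaces hlm
      ⟨v l, hv l⟩ ⟨v m, hv m⟩
  have hpos : ∀ l, v l ≠ 0 → 0 < l := by
    intro l hl
    have h1 := integral_sq_pos hk hπ hl
    rw [← inner_covOperator hk, ← hC, hCv, real_inner_smul_left] at h1
    exact pos_of_mul_pos_left h1 real_inner_self_nonneg
  -- Formally `h = L^(r-1) w`, chosen so that `⟨μ, w⟩ = ⟨L^r g, w⟩_H` becomes the `L²` pairing of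
  -- `h` and `g`.
  set h : H := v.sum fun l x => l ^ (r - 1) • x with hh
  have hin : ∀ l, inner ℝ μ (v l) = l ^ (r - 1) * ∫ a, v l a * g a ∂π := by
    intro l
    by_cases hl : v l = 0
    · simp [hl]
    have hl0 := hpos l hl
    have h1 := hμ l (v l) (hCv l)
    rw [← inner_covOperator hk, ← hC, hCv, real_inner_smul_left, real_inner_comm] at h1
    rw [Real.rpow_sub_one hl0.ne']
    field_simp
    linarith
  have hmul : ∀ u : H, Integrable (fun a => u a * g a) π := fun u =>
    (memLp_coe hk u).integrable_mul hg
  have hμw : inner ℝ μ (v.sum fun _ x => x) = ∫ a, h a * g a ∂π := by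
    have : (fun a => h a * g a) = fun a => ∑ l ∈ v.support, l ^ (r - 1) * (v l a * g a) := by
      ext a
      simp only [hh, Finsupp.sum, coe_sum, Finset.sum_mul, RKHS.coe_smul, Pi.smul_apply,
        smul_eq_mul, mul_assoc]
    rw [this, integral_finsetSum _ fun l _ => (hmul (v l)).const_mul _, Finsupp.sum, inner_sum]
    exact Finset.sum_congr rfl fun l _ => by rw [hin, integral_const_mul]
  have hsum : ∀ b c : ℝ → ℝ, inner ℝ (∑ l ∈ v.support, b l • v l) (∑ l ∈ v.support, c l • v l) =
      ∑ l ∈ v.support, b l * c l * ‖v l‖ ^ 2 := by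
    intro b c
    simp only [sum_inner, inner_sum, real_inner_smul_left, real_inner_smul_right]
    refine Finset.sum_congr rfl fun l hl => ?_
    rw [Finset.sum_eq_single l]
    · rw [real_inner_self_eq_norm_sq]; ring
    · intro m _ hml
      rw [horth _ _ hml]; simp
    · exact fun hl' => absurd hl hl'
  have hww : ‖v.sum fun _ x => x‖ ^ 2 = ∑ l ∈ v.support, ‖v l‖ ^ 2 := by
    have := hsum (fun _ => 1) (fun _ => 1)
    simpa only [one_smul, one_mul, real_inner_self_eq_norm_sq, Finsupp.sum] using this
  have hCww : inner ℝ (C (v.sum fun _ x => x)) (v.sum fun _ x => x) =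
      ∑ l ∈ v.support, l * ‖v l‖ ^ 2 := by
    have := hsum (fun l => l) (fun _ => 1)
    simpa only [one_smul, mul_one, Finsupp.sum, map_sum, hCv] using this
  have hhh : ∫ a, h a * h a ∂π = ∑ l ∈ v.support, l ^ (2 * r - 1) * ‖v l‖ ^ 2 := by
    rw [← inner_covOperator hk, ← hC]
    have := hsum (fun l => l ^ (r - 1) * l) (fun l => l ^ (r - 1))
    simp only [hh, Finsupp.sum, map_sum, map_smul, hCv, smul_smul]
    rw [this]
    refine Finset.sum_congr rfl fun l hl => ?_
    have hl0 := hpos l (Finsupp.mem_support_iff.1 hl)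
    congr 1
    nth_rw 2 [← Real.rpow_one l]
    rw [← Real.rpow_add hl0, ← Real.rpow_add hl0]
    ring_nf
  set θ := 2 * r - 1 with hθ
  have hsθ : 0 < s ^ θ := Real.rpow_pos_of_pos hs _
  -- Young's inequality; the weight `s ^ θ` makes the `h` term a sum of `(l / s) ^ θ ‖v l‖²`, which
  -- `rpow_le_one_add` bounds by `(1 + l / s) ‖v l‖²` since `0 ≤ θ ≤ 1`.
  have hamgm : 2 * ∫ a, h a * g a ∂π ≤
      (s ^ θ)⁻¹ * ∫ a, h a * h a ∂π + s ^ θ * ∫ a, g a * g a ∂π := by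
    have i1 : Integrable (fun a => h a * h a) π := (memLp_coe hk h).integrable_mul (memLp_coe hk h)
    have i2 : Integrable (fun a => g a * g a) π := hg.integrable_mul hg
    rw [← integral_const_mul, ← integral_const_mul, ← integral_const_mul,
      ← integral_add (i1.const_mul _) (i2.const_mul _)]
    refine integral_mono ((hmul h).const_mul _) ((i1.const_mul _).add (i2.const_mul _)) fun a => ?_
    have : 0 ≤ (s ^ θ)⁻¹ * (h a - s ^ θ * g a) ^ 2 := by positivity
    have e : (s ^ θ)⁻¹ * (h a - s ^ θ * g a) ^ 2 =
      (s ^ θ)⁻¹ * (h a * h a) + s ^ θ * (g a * g a) - 2 * (h a * g a) := by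
      field_simp; ring
    linarith
  have hterm : (s ^ θ)⁻¹ * ∫ a, h a * h a ∂π ≤
      (∑ l ∈ v.support, ‖v l‖ ^ 2) + (∑ l ∈ v.support, l * ‖v l‖ ^ 2) / s := by
    rw [hhh, Finset.mul_sum, Finset.sum_div, ← Finset.sum_add_distrib]
    refine Finset.sum_le_sum fun l hl => ?_
    have hl0 := hpos l (Finsupp.mem_support_iff.1 hl)
    have h1 := rpow_le_one_add (div_pos hl0 hs).le (θ := θ) (by linarith) (by linarith)
    rw [Real.div_rpow hl0.le hs.le] at h1
    calc (s ^ θ)⁻¹ * (l ^ θ * ‖v l‖ ^ 2) = l ^ θ / s ^ θ * ‖v l‖ ^ 2 := by ring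
      _ ≤ (1 + l / s) * ‖v l‖ ^ 2 := by gcongr
      _ = _ := by ring
  rw [hμw, hww, hCww]
  linarith

/-- If `μ = L^r g` for the integral operator `L` of a nondegenerate probability measure, then
`2 ⟨μ, w⟩ ≤ ‖w‖² + ‖w‖²_{L²} / s + s^(2r-1) ‖g‖²_{L²}` for all `w` and `s > 0`. -/
theorem two_inner_le_of_forall_eigenvector (hk : Continuous fun a : X => kernelSection H a)
    (hπ : ∀ U : Set X, IsOpen U → U.Nonempty → 0 < π U) {g : X → ℝ} (hg : MemLp g 2 π)
    {r : ℝ} (hr : 1 / 2 < r) (hr' : r ≤ 1) {μ : H}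
    (hμ : ∀ (l : ℝ) (u : H), covOperator H π u = l • u →
      ∫ a, u a * μ a ∂π = l ^ r * ∫ a, u a * g a ∂π)
    {s : ℝ} (hs : 0 < s) (w : H) :
    2 * inner ℝ μ w ≤ ‖w‖ ^ 2 + (∫ a, w a * w a ∂π) / s +
      s ^ (2 * r - 1) * ∫ a, g a * g a ∂π := by
  rw [← inner_covOperator hk]
  -- By the spectral theorem for compact symmetric operators; both sides are continuous in `w`, so
  -- the inequality extends to all of `H`.
  have hd : Dense ((⨆ l, Module.End.eigenspace (covOperator H π : Module.End ℝ H) l :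
      Submodule ℝ H) : Set H) := by
    rw [Submodule.dense_iff_topologicalClosure_eq_top, Submodule.topologicalClosure_eq_top_iff]
    exact ContinuousLinearMap.orthogonalComplement_iSup_eigenspaces_eq_bot
      (isCompactOperator_covOperator hk) (isSymmetric_covOperator hk)
  refine hd.induction (P := fun w => 2 * inner ℝ μ w ≤ ‖w‖ ^ 2 +
    inner ℝ (covOperator H π w) w / s + s ^ (2 * r - 1) * ∫ a, g a * g a ∂π)
    (fun w hw => two_inner_le_of_mem_iSup_eigenspace hk hπ hg hr hr' hμ hs hw) ?_ w
  exact isClosed_le (by fun_prop) (by fun_prop)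

end SpectralInequality

/-! ### The source condition for a single density. -/

section Densities

variable {X : Set Plane}

theorem isFiniteMeasure_lebesgueOn (hX : IsCompact X) : IsFiniteMeasure (lebesgueOn X) := by
  refine ⟨?_⟩
  rw [lebesgueOn, comap_subtype_coe_apply hX.isClosed.measurableSet]
  simpa using hX.measure_lt_top

theorem IsNondegenerateDensity.isProbabilityMeasure {p : X → ℝ} (hp : IsNondegenerateDensity p) :
    IsProbabilityMeasure (densityMeasure p) := by
  refine ⟨?_⟩
  rw [densityMeasure, withDensity_apply _ MeasurableSet.univ, Measure.restrict_univ,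
    hp.lintegral_eq_one]

variable {K : X → X → ℝ} {H : Type*} [NormedAddCommGroup H] [InnerProductSpace ℝ H]
  [CompleteSpace H] [RKHS ℝ H X ℝ]

/-- Consequently an eigenvector of the covariance operator in `H` is, as a class in `L²_p`, an
eigenvector of `L_p` with the same eigenvalue, and `IsPowImage` can be tested on it. -/
theorem integralOp_eq_covOperator [CompactSpace X] (hHK : ∀ a b : X, RKHS.kernel H a b 1 = K a b)
    (hk : Continuous fun a : X => kernelSection H a) {p : X → ℝ}
    [IsProbabilityMeasure (densityMeasure p)] {u : H} {f : X → ℝ}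
    (hf : f =ᵐ[densityMeasure p] u) :
    integralOp K p f = covOperator H (densityMeasure p) u := by
  ext b
  rw [← inner_kernelSection, inner_covOperator hk, integralOp]
  refine integral_congr_ae ?_
  filter_upwards [hf] with a ha
  rw [ha, ← hHK, ← kernelSection_apply, ← inner_kernelSection (kernelSection H a), real_inner_comm,
    inner_kernelSection, mul_comm]

/-- The quantitative form in which the source condition is used: it is stable under averaging over
the density. -/
theorem two_inner_le_of_negPowNorm_lt (hX : IsCompact X)
    (hHK : ∀ a b : X, RKHS.kernel H a b 1 = K a b)
    (hk : Continuous fun a : X => kernelSection H a) {p : X → ℝ} (hp : IsNondegenerateDensity p)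
    {r : ℝ} (hr : 1 / 2 < r) (hr' : r ≤ 1) {μ : H} {B : ℝ≥0}
    (hB : negPowNorm K p r μ < B) {s : ℝ} (hs : 0 < s) (w : H) :
    2 * inner ℝ μ w ≤ ‖w‖ ^ 2 + (∫ a, w a * w a ∂(densityMeasure p)) / s +
      s ^ (2 * r - 1) * B ^ 2 := by
  have : CompactSpace X := isCompact_iff_compactSpace.1 hX
  have := hp.isProbabilityMeasure
  simp only [negPowNorm, iInf_lt_iff] at hB
  obtain ⟨g, hg, hgB⟩ := hB
  have hg2 : ∫ a, g a * g a ∂(densityMeasure p) ≤ B ^ 2 := by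
    have h1 : ‖g‖ ^ 2 = ∫ a, g a * g a ∂(densityMeasure p) := by
      rw [← real_inner_self_eq_norm_sq, L2.inner_def]
      simp [pow_two]
    have h2 : ‖g‖ ≤ B := by
      rw [Lp.norm_def]
      exact ENNReal.toReal_le_of_le_ofReal B.2 (hgB.le.trans_eq (by simp))
    rw [← h1]
    gcongr
  refine (two_inner_le_of_forall_eigenvector hk hp.pos_of_isOpen (Lp.memLp g) hr hr' ?_ hs w).trans
    (by gcongr)
  intro l u hu
  have hφ := (memLp_coe (π := densityMeasure p) hk u).coeFn_toLp
  have h1 := hg l (memLp_coe hk u).toLp (by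
    rw [integralOp_eq_covOperator hHK hk hφ, hu]
    filter_upwards [hφ] with a ha
    rw [ha, RKHS.coe_smul, Pi.smul_apply, smul_eq_mul])
  have h2 := integral_congr_ae (hφ.mul (ae_eq_refl μ))
  have h3 := integral_congr_ae (hφ.mul (ae_eq_refl g))
  simp only [Pi.mul_apply] at h2 h3
  rwa [h2, h3] at h1

end Densities

/-! ### Averaging over random densities. -/

section Mixture

variable {X : Set Plane} {Ω : Type*} [MeasurableSpace Ω] {P : Measure Ω} {𝒟 : Set (X → ℝ)}
  {x : ℕ → Ω → X} {p : ℕ → Ω → X → ℝ}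

theorem IsDrawnFrom.measurable_densityMeasure (hX : IsCompact X) (hx : IsDrawnFrom P 𝒟 x p)
    (i : ℕ) : Measurable fun ω => densityMeasure (p i ω) := by
  have := isFiniteMeasure_lebesgueOn hX
  refine Measure.measurable_of_measurable_coe _ fun B hB => ?_
  simp only [densityMeasure, withDensity_apply _ hB]
  exact (hx.measurable_density i).ennreal_ofReal.lintegral_prod_right'

theorem IsDrawnFrom.map_eq_bind (hX : IsCompact X) (hx : IsDrawnFrom P 𝒟 x p) (i : ℕ) :
    P.map (x i) = P.bind fun ω => densityMeasure (p i ω) := by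
  ext B hB
  rw [Measure.map_apply (hx.measurable i) hB, hx.law i B hB,
    Measure.bind_apply hB (hx.measurable_densityMeasure hX i).aemeasurable]

/-- A lower bound for the integral of a continuous function against every density in `𝒟` also holds
in expectation. -/
theorem IsDrawnFrom.le_integral_comp [IsProbabilityMeasure P] (hX : IsCompact X)
    (hx : IsDrawnFrom P 𝒟 x p) (h𝒟 : ∀ q ∈ 𝒟, IsNondegenerateDensity q) {f : X → ℝ}
    (hf : Continuous f) (hf0 : ∀ a, 0 ≤ f a) {c : ℝ}
    (hc : ∀ q ∈ 𝒟, c ≤ ∫ a, f a ∂(densityMeasure q)) (i : ℕ) :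
    c ≤ ∫ ω, f (x i ω) ∂P := by
  have : CompactSpace X := isCompact_iff_compactSpace.1 hX
  have : IsProbabilityMeasure (P.map (x i)) :=
    Measure.isProbabilityMeasure_map (hx.measurable i).aemeasurable
  rw [← integral_map (hx.measurable i).aemeasurable hf.aestronglyMeasurable]
  have hpos : 0 ≤ ∫ a, f a ∂(P.map (x i)) := integral_nonneg hf0
  rw [← ENNReal.ofReal_le_ofReal_iff hpos,
    ofReal_integral_eq_lintegral_ofReal hf.integrable_of_compactSpace
      (Eventually.of_forall hf0), hx.map_eq_bind hX,
    Measure.lintegral_bind (hx.measurable_densityMeasure hX i).aemeasurable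
      hf.measurable.ennreal_ofReal.aemeasurable]
  calc ENNReal.ofReal c = ∫⁻ _, ENNReal.ofReal c ∂P := by simp
    _ ≤ _ := lintegral_mono fun ω => by
      have hq := hx.density_mem i ω
      have := (h𝒟 _ hq).isProbabilityMeasure
      rw [← ofReal_integral_eq_lintegral_ofReal hf.integrable_of_compactSpace
        (Eventually.of_forall hf0)]
      exact ENNReal.ofReal_le_ofReal (hc _ hq)

variable {K : X → X → ℝ} {H : Type*} [NormedAddCommGroup H] [InnerProductSpace ℝ H]
  [CompleteSpace H] [RKHS ℝ H X ℝ]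

theorem two_inner_le_integral_comp [IsProbabilityMeasure P] (hX : IsCompact X)
    (hHK : ∀ a b : X, RKHS.kernel H a b 1 = K a b)
    (hk : Continuous fun a : X => kernelSection H a)
    (hx : IsDrawnFrom P 𝒟 x p) (h𝒟 : ∀ q ∈ 𝒟, IsNondegenerateDensity q)
    {r : ℝ} (hr : 1 / 2 < r) (hr' : r ≤ 1) {μ : H} (hμ : SourceCondition K 𝒟 r μ) :
    ∃ B : ℝ≥0, ∀ s : ℝ, 0 < s → ∀ (w : H) (i : ℕ),
      2 * inner ℝ μ w ≤ ‖w‖ ^ 2 + (∫ ω, w (x i ω) ^ 2 ∂P) / s + s ^ (2 * r - 1) * B ^ 2 := by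
  obtain ⟨B, hB⟩ := ENNReal.lt_iff_exists_nnreal_btwn.1 hμ
  refine ⟨B, fun s hs w i => ?_⟩
  -- Solved for the second moment, the inequality has a left side independent of the density, hence
  -- it is a lower bound that passes to the mixture.
  have key : s * (2 * inner ℝ μ w - ‖w‖ ^ 2 - s ^ (2 * r - 1) * B ^ 2) ≤
      ∫ ω, w (x i ω) ^ 2 ∂P := by
    refine hx.le_integral_comp (f := fun a => w a ^ 2) hX h𝒟 ((continuous_coe hk w).pow 2)
      (fun a => sq_nonneg _) (fun q hq => ?_) i
    have h1 := two_inner_le_of_negPowNorm_lt hX hHK hk (h𝒟 q hq) hr hr' (μ := μ) (B := B)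
      (lt_of_le_of_lt (le_iSup₂ (f := fun q (_ : q ∈ convexHull ℝ 𝒟) => negPowNorm K q r μ) q
        (subset_convexHull ℝ 𝒟 hq)) hB.1) hs w
    simp only [pow_two (w _)]
    rw [← le_div_iff₀' hs]
    linarith
  rw [← le_div_iff₀' hs] at key
  linarith

end Mixture

/-! ### Uniform law of large numbers under covariance decay. -/

section LawOfLargeNumbers

/-- Covariance decay controls only sums forward in time; symmetry reduces the variance of a sum to
these, and the diagonal terms, being variances, can be dropped. -/
theorem sum_sum_add_sum_diag {c : ℕ → ℕ → ℝ} (hc : ∀ i j, c i j = c j i) (t : ℕ) :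
    ∑ i ∈ Finset.range t, ∑ j ∈ Finset.range t, c i j + ∑ i ∈ Finset.range t, c i i =
      2 * ∑ i ∈ Finset.range t, ∑ k ∈ Finset.range (t - i), c i (i + k) := by
  simp only [← Finset.sum_Ico_eq_sum_range]
  induction t with
  | zero => simp
  | succ t ih =>
    have h1 : ∑ i ∈ Finset.range (t + 1), ∑ j ∈ Finset.Ico i (t + 1), c i j =
        ∑ i ∈ Finset.range t, ∑ j ∈ Finset.Ico i t, c i j + ∑ i ∈ Finset.range t, c i t + c t t := by
      rw [Finset.sum_range_succ, ← Finset.sum_add_distrib]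
      congr 1
      · exact Finset.sum_congr rfl fun i hi =>
          Finset.sum_Ico_succ_top (Finset.mem_range.1 hi).le _
      · simp
    have h2 : ∑ j ∈ Finset.range t, c t j = ∑ j ∈ Finset.range t, c j t :=
      Finset.sum_congr rfl fun j _ => hc _ _
    rw [h1]
    simp only [Finset.sum_range_succ, Finset.sum_add_distrib, h2]
    linarith

variable {X : Set Plane} {𝒟 : Set (X → ℝ)}

/-- Covariance decay asks for norm bounds over the whole convex hull, so total mass one is needed
there too. -/
theorem densityMeasure_univ_of_mem_convexHull (h𝒟 : ∀ q ∈ 𝒟, IsNondegenerateDensity q)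
    {q : X → ℝ} (hq : q ∈ convexHull ℝ 𝒟) : densityMeasure q univ = 1 := by
  have hconv : Convex ℝ {q : X → ℝ | Measurable q ∧ (∀ a, 0 ≤ q a) ∧
      ∫⁻ a, ENNReal.ofReal (q a) ∂(lebesgueOn X) = 1} := by
    rintro q₁ ⟨m₁, n₁, i₁⟩ q₂ ⟨m₂, n₂, i₂⟩ b₁ b₂ hb₁ hb₂ hb
    refine ⟨(m₁.const_smul b₁).add (m₂.const_smul b₂),
      fun a => add_nonneg (mul_nonneg hb₁ (n₁ a)) (mul_nonneg hb₂ (n₂ a)), ?_⟩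
    have : ∀ a, ENNReal.ofReal ((b₁ • q₁ + b₂ • q₂) a) =
        ENNReal.ofReal b₁ * ENNReal.ofReal (q₁ a) + ENNReal.ofReal b₂ * ENNReal.ofReal (q₂ a) := by
      intro a
      rw [← ENNReal.ofReal_mul hb₁, ← ENNReal.ofReal_mul hb₂,
        ← ENNReal.ofReal_add (mul_nonneg hb₁ (n₁ a)) (mul_nonneg hb₂ (n₂ a))]
      rfl
    simp only [this]
    rw [lintegral_add_left (m₁.ennreal_ofReal.const_mul _),
      lintegral_const_mul _ m₁.ennreal_ofReal, lintegral_const_mul _ m₂.ennreal_ofReal, i₁, i₂,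
      mul_one, mul_one, ← ENNReal.ofReal_add hb₁ hb₂, hb, ENNReal.ofReal_one]
  have hsub : 𝒟 ⊆ {q : X → ℝ | Measurable q ∧ (∀ a, 0 ≤ q a) ∧
      ∫⁻ a, ENNReal.ofReal (q a) ∂(lebesgueOn X) = 1} := fun q hq =>
    ⟨(h𝒟 q hq).measurable, (h𝒟 q hq).nonneg, (h𝒟 q hq).lintegral_eq_one⟩
  rw [densityMeasure, withDensity_apply _ MeasurableSet.univ, Measure.restrict_univ]
  exact (convexHull_min hsub hconv hq).2.2

theorem normP_le_of_abs_le_one (h𝒟 : ∀ q ∈ 𝒟, IsNondegenerateDensity q) {q : X → ℝ}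
    (hq : q ∈ convexHull ℝ 𝒟) {f : X → ℝ} (hf : ∀ a, |f a| ≤ 1) : normP q f ≤ 1 := by
  refine (eLpNorm_le_of_ae_bound (C := 1) (Eventually.of_forall hf)).trans ?_
  rw [densityMeasure_univ_of_mem_convexHull h𝒟 hq]
  simp

variable {Ω : Type*} [MeasurableSpace Ω] {P : Measure Ω} [IsProbabilityMeasure P]
  {x : ℕ → Ω → X}

theorem integrable_comp_of_abs_le (hx : ∀ i, Measurable (x i)) {f : X → ℝ} (hf : Measurable f)
    {C : ℝ} (hC : ∀ a, |f a| ≤ C) (i : ℕ) : Integrable (fun ω => f (x i ω)) P :=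
  Integrable.of_bound (hf.comp (hx i)).aestronglyMeasurable C (Eventually.of_forall fun _ => hC _)

theorem memLp_comp_of_abs_le (hx : ∀ i, Measurable (x i)) {f : X → ℝ} (hf : Measurable f)
    {C : ℝ} (hC : ∀ a, |f a| ≤ C) (i : ℕ) : MemLp (fun ω => f (x i ω)) 2 P :=
  MemLp.of_bound (hf.comp (hx i)).aestronglyMeasurable C (Eventually.of_forall fun _ => hC _)

theorem CovarianceDecay.exists_variance_sum_le (h𝒟 : ∀ q ∈ 𝒟, IsNondegenerateDensity q)
    (hx : ∀ i, Measurable (x i)) {ν : ℕ → Ω → ℝ} (hA : CovarianceDecay P 𝒟 x ν) :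
    ∃ A : ℝ, ∀ f : X → ℝ, Measurable f → (∀ a, |f a| ≤ 1) → ∀ t : ℕ,
      Var[fun ω => ∑ i ∈ Finset.range t, f (x i ω); P] ≤ 2 * A * t := by
  -- Functions bounded by one have all norms at most `1 < 2`, so a single `A` serves them all; the
  -- noise is removed below with `f₂ = 0`.
  obtain ⟨A, hA⟩ := hA 2
  refine ⟨A, fun f hf hf1 t => ?_⟩
  have hL : ∀ i, MemLp (fun ω => f (x i ω)) 2 P := memLp_comp_of_abs_le hx hf hf1
  have hcov : ∀ i n : ℕ, ∑ k ∈ Finset.range (n + 1),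
      cov[fun ω => f (x i ω), fun ω => f (x (i + k) ω); P] < A := by
    intro i n
    refine (le_abs_self _).trans_lt ?_
    have := hA f (fun _ => 0) hf measurable_const (fun q hq => ⟨?_, ?_⟩) i n
    · simpa only [zero_mul, add_zero] using this
    · exact (normP_le_of_abs_le_one h𝒟 hq hf1).trans_lt (by simp)
    · exact (normP_le_of_abs_le_one h𝒟 hq (by simp)).trans_lt (by simp)
  rw [variance_fun_sum' (fun i _ => hL i)]
  have h1 := sum_sum_add_sum_diag
    (c := fun i j => cov[fun ω => f (x i ω), fun ω => f (x j ω); P])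
    (fun i j => covariance_comm _ _) t
  have h2 : 0 ≤ ∑ i ∈ Finset.range t, cov[fun ω => f (x i ω), fun ω => f (x i ω); P] :=
    Finset.sum_nonneg fun i _ => by
      rw [covariance_self (hL i).aemeasurable]
      exact variance_nonneg _ _
  have h3 : ∑ i ∈ Finset.range t, ∑ k ∈ Finset.range (t - i),
      cov[fun ω => f (x i ω), fun ω => f (x (i + k) ω); P] ≤ ∑ i ∈ Finset.range t, A := by
    refine Finset.sum_le_sum fun i hi => ?_
    have := hcov i (t - i - 1)
    rw [Nat.sub_add_cancel (Nat.sub_pos_of_lt (Finset.mem_range.1 hi))] at this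
    exact this.le
  rw [Finset.sum_const, Finset.card_range, nsmul_eq_mul] at h3
  linarith

/-- The deviation of the empirical mean of `f` along the locations from its expectation. -/
noncomputable def meanDeviation (P : Measure Ω) (x : ℕ → Ω → X) (t : ℕ) (f : X → ℝ) (ω : Ω) : ℝ :=
  (∑ i ∈ Finset.range t, f (x i ω)) / t - (∑ i ∈ Finset.range t, ∫ ω', f (x i ω') ∂P) / t

theorem tendsto_measure_le_abs_meanDeviation (h𝒟 : ∀ q ∈ 𝒟, IsNondegenerateDensity q)
    (hx : ∀ i, Measurable (x i)) {ν : ℕ → Ω → ℝ} (hA : CovarianceDecay P 𝒟 x ν) {f : X → ℝ}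
    (hf : Measurable f) (hf1 : ∀ a, |f a| ≤ 1) {η : ℝ} (hη : 0 < η) :
    Tendsto (fun t => P {ω | η ≤ |meanDeviation P x t f ω|}) atTop (𝓝 0) := by
  obtain ⟨A, hA⟩ := hA.exists_variance_sum_le h𝒟 hx
  have hlim : Tendsto (fun t : ℕ => ENNReal.ofReal (2 * A / η ^ 2 * (t : ℝ)⁻¹)) atTop (𝓝 0) := by
    have := ENNReal.tendsto_ofReal
      ((tendsto_inv_atTop_nhds_zero_nat (𝕜 := ℝ)).const_mul (2 * A / η ^ 2))
    simpa using this
  refine tendsto_of_tendsto_of_tendsto_of_le_of_le' tendsto_const_nhds hlim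
    (Eventually.of_forall fun _ => zero_le) ?_
  filter_upwards [eventually_ge_atTop 1] with t ht
  have ht0 : (0 : ℝ) < t := by exact_mod_cast ht
  have hL : MemLp (fun ω => ∑ i ∈ Finset.range t, f (x i ω)) 2 P :=
    memLp_finsetSum _ fun i _ => memLp_comp_of_abs_le hx hf hf1 i
  have hcheb := meas_ge_le_variance_div_sq hL (mul_pos hη ht0)
  refine (measure_mono fun ω hω => ?_).trans (hcheb.trans (ENNReal.ofReal_le_ofReal ?_))
  · rw [mem_ofPred_eq] at hω ⊢
    rw [integral_finsetSum _ fun i _ => integrable_comp_of_abs_le hx hf hf1 i]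
    rwa [meanDeviation, ← sub_div, abs_div, abs_of_pos ht0, le_div_iff₀ ht0] at hω
  · calc _ ≤ 2 * A * t / (η * t) ^ 2 := by gcongr; exact hA f hf hf1 t
      _ = _ := by field_simp

theorem meanDeviation_sum (hx : ∀ i, Measurable (x i)) {ι : Type*} (s : Finset ι) (c : ι → ℝ)
    {f : ι → X → ℝ} (hf : ∀ j, Measurable (f j)) {C : ℝ} (hC : ∀ j a, |f j a| ≤ C)
    (t : ℕ) (ω : Ω) :
    meanDeviation P x t (fun a => ∑ j ∈ s, c j * f j a) ω =
      ∑ j ∈ s, c j * meanDeviation P x t (f j) ω := by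
  have : ∀ i, ∫ ω', ∑ j ∈ s, c j * f j (x i ω') ∂P = ∑ j ∈ s, c j * ∫ ω', f j (x i ω') ∂P := by
    intro i
    rw [integral_finsetSum _ fun j _ => (integrable_comp_of_abs_le hx (hf j) (hC j) i).const_mul _]
    simp only [integral_const_mul]
  simp only [meanDeviation, this, mul_sub, Finset.sum_sub_distrib]
  rw [Finset.sum_comm, Finset.sum_comm (s := Finset.range t)]
  simp only [Finset.sum_div, Finset.mul_sum, mul_div_assoc]

theorem abs_meanDeviation_sub_le (hx : ∀ i, Measurable (x i)) {f g : X → ℝ}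
    (hf : Measurable f) (hg : Measurable g) {C : ℝ} (hC : ∀ a, |f a| ≤ C) (hC' : ∀ a, |g a| ≤ C)
    {ε : ℝ} (h : ∀ a, |f a - g a| ≤ ε) (t : ℕ) (ω : Ω) :
    |meanDeviation P x t f ω - meanDeviation P x t g ω| ≤ 2 * ε := by
  have hε : 0 ≤ ε := (abs_nonneg _).trans (h (x 0 ω))
  have hdiff : ∀ i, |∫ ω', f (x i ω') ∂P - ∫ ω', g (x i ω') ∂P| ≤ ε := by
    intro i
    rw [← integral_sub (integrable_comp_of_abs_le hx hf hC i)
      (integrable_comp_of_abs_le hx hg hC' i)]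
    simpa using norm_integral_le_of_norm_le_const (μ := P)
      (f := fun ω' => f (x i ω') - g (x i ω')) (Eventually.of_forall fun ω' => h (x i ω'))
  have e : meanDeviation P x t f ω - meanDeviation P x t g ω =
      (∑ i ∈ Finset.range t, ((f (x i ω) - g (x i ω)) -
        (∫ ω', f (x i ω') ∂P - ∫ ω', g (x i ω') ∂P))) / t := by
    simp only [meanDeviation, Finset.sum_sub_distrib]
    ring
  rw [e, abs_div, Nat.abs_cast]
  refine div_le_of_le_mul₀ (Nat.cast_nonneg t) (by positivity) ?_
  calc _ ≤ ∑ i ∈ Finset.range t, |(f (x i ω) - g (x i ω)) -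
        (∫ ω', f (x i ω') ∂P - ∫ ω', g (x i ω') ∂P)| := Finset.abs_sum_le_sum_abs _ _
    _ ≤ ∑ i ∈ Finset.range t, 2 * ε := Finset.sum_le_sum fun i _ => by
        linarith [abs_sub (f (x i ω) - g (x i ω)) (∫ ω', f (x i ω') ∂P - ∫ ω', g (x i ω') ∂P),
          h (x i ω), hdiff i]
    _ = _ := by simp [mul_comm]

/-- A continuous map on a compact space is uniformly close to its composition with a simple
function. -/
theorem exists_simpleFunc_norm_sub_le {Y E : Type*} [PseudoMetricSpace Y] [CompactSpace Y]
    [Nonempty Y] [MeasurableSpace Y] [OpensMeasurableSpace Y] [NormedAddCommGroup E] {k : Y → E}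
    (hk : Continuous k) {ε : ℝ} (hε : 0 < ε) :
    ∃ φ : SimpleFunc Y Y, ∀ a, ‖k a - k (φ a)‖ ≤ ε := by
  obtain ⟨δ, hδ, h⟩ := Metric.uniformContinuous_iff.1
    (CompactSpace.uniformContinuous_of_continuous hk) ε hε
  let e := TopologicalSpace.denseSeq Y
  obtain ⟨s, hs⟩ := isCompact_univ.elim_finite_subcover (fun n => Metric.ball (e n) δ)
    (fun _ => Metric.isOpen_ball) fun a _ => by
      obtain ⟨n, hn⟩ := (TopologicalSpace.denseRange_denseSeq Y).exists_dist_lt a hδ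
      exact mem_iUnion.2 ⟨n, hn⟩
  refine ⟨SimpleFunc.nearestPt e (s.sup id), fun a => ?_⟩
  rw [← dist_eq_norm]
  refine (h ?_).le
  obtain ⟨n, hns, hn⟩ := mem_iUnion₂.1 (hs (mem_univ a))
  have h1 := SimpleFunc.edist_nearestPt_le e a (Finset.le_sup (f := id) hns)
  rw [id, edist_dist, edist_dist, ENNReal.ofReal_le_ofReal_iff dist_nonneg] at h1
  rw [dist_comm]
  exact h1.trans_lt (by rw [dist_comm]; exact hn)

/-- Uniform law of large numbers for the squares of the functions in the unit ball of the
reproducing kernel Hilbert space. -/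
theorem tendsto_measure_exists_lt_abs_meanDeviation (hX : IsCompact X)
    {H : Type*} [NormedAddCommGroup H] [InnerProductSpace ℝ H] [CompleteSpace H] [RKHS ℝ H X ℝ]
    (hk : Continuous fun a : X => kernelSection H a)
    (h𝒟 : ∀ q ∈ 𝒟, IsNondegenerateDensity q)
    (hx : ∀ i, Measurable (x i)) {ν : ℕ → Ω → ℝ} (hA : CovarianceDecay P 𝒟 x ν)
    {δ : ℝ} (hδ : 0 < δ) :
    Tendsto (fun t => P {ω | ∃ w : H, δ * ‖w‖ ^ 2 < |meanDeviation P x t (fun a => w a ^ 2) ω|})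
      atTop (𝓝 0) := by
  have : CompactSpace X := isCompact_iff_compactSpace.1 hX
  have : Nonempty X := P.nonempty_of_neZero.map (x 0)
  obtain ⟨κ, hκ1, hκ⟩ := exists_norm_kernelSection_le hk
  have hκ0 : 0 < κ := by linarith
  -- With this accuracy `w²` and `(w ∘ φ)²` differ by at most `2κ‖w‖ · ‖w‖ δ/(8κ) = (δ/4) ‖w‖²`,
  -- whatever `w` is; the mean deviations differ by at most twice that.
  obtain ⟨φ, hφ⟩ := exists_simpleFunc_norm_sub_le hk (show 0 < δ / (8 * κ) by positivity)
  -- Chosen so that the cells of `φ` together contribute at most `(δ/2) ‖w‖²`, each coefficient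
  -- being at most `κ² ‖w‖²`.
  set η := δ / (2 * κ ^ 2 * (φ.range.card + 1)) with hη
  have hη0 : 0 < η := by positivity
  let χ : X → X → ℝ := fun j => (φ ⁻¹' {j}).indicator 1
  have hχm : ∀ j, Measurable (χ j) := fun j =>
    measurable_one.indicator (φ.measurableSet_preimage _)
  have hχ1 : ∀ j a, |χ j a| ≤ 1 := fun j a => by
    by_cases h : a ∈ φ ⁻¹' {j} <;> simp [χ, h]
  have hlim : Tendsto (fun t => ∑ j ∈ φ.range, P {ω | η ≤ |meanDeviation P x t (χ j) ω|})
      atTop (𝓝 0) := by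
    have := tendsto_finsetSum φ.range fun j _ =>
      tendsto_measure_le_abs_meanDeviation h𝒟 hx hA (hχm j) (hχ1 j) hη0
    simpa using this
  refine tendsto_of_tendsto_of_tendsto_of_le_of_le tendsto_const_nhds hlim
    (fun _ => zero_le) fun t => ?_
  refine (measure_mono ?_).trans (measure_biUnion_finset_le _ _)
  rintro ω ⟨w, hw⟩
  by_contra hcon
  simp only [mem_iUnion, mem_ofPred_eq, not_exists, not_le] at hcon
  have hwm : Measurable w := (continuous_coe hk w).measurable
  have hwb : ∀ a, w a ^ 2 ≤ κ ^ 2 * ‖w‖ ^ 2 := fun a => by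
    rw [← sq_abs, ← mul_pow]
    exact pow_le_pow_left₀ (abs_nonneg _) (abs_apply_le hκ w a) 2
  have hwb' : ∀ a, |w a ^ 2| ≤ κ ^ 2 * ‖w‖ ^ 2 := fun a => by
    rw [abs_of_nonneg (sq_nonneg _)]; exact hwb a
  -- Uniformity comes from here: only the coefficients depend on `w`, while the indicators form a
  -- fixed finite family.
  have hsimple : (fun a => w (φ a) ^ 2) = fun a => ∑ j ∈ φ.range, w j ^ 2 * χ j a := by
    ext a
    rw [Finset.sum_eq_single (φ a)]
    · simp [χ]
    · intro j _ hj
      simp [χ, hj.symm]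
    · exact fun h => absurd (SimpleFunc.mem_range_self φ a) h
  have h1 := abs_meanDeviation_sub_le (P := P) (ε := δ / 4 * ‖w‖ ^ 2) hx (hwm.pow_const 2)
    ((hwm.comp φ.measurable).pow_const 2) hwb' (fun a => hwb' (φ a)) (fun a => ?_) t ω
  · have h2 : |meanDeviation P x t (fun a => w (φ a) ^ 2) ω| ≤ δ / 2 * ‖w‖ ^ 2 := by
      rw [hsimple, meanDeviation_sum hx φ.range (fun j => w j ^ 2) hχm hχ1]
      calc _ ≤ ∑ j ∈ φ.range, |w j ^ 2 * meanDeviation P x t (χ j) ω| :=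
            Finset.abs_sum_le_sum_abs _ _
        _ ≤ ∑ j ∈ φ.range, κ ^ 2 * ‖w‖ ^ 2 * η := Finset.sum_le_sum fun j hj => by
            rw [abs_mul]
            exact mul_le_mul (hwb' j) (hcon j hj).le (abs_nonneg _) (by positivity)
        _ = φ.range.card / (φ.range.card + 1) * (δ / 2 * ‖w‖ ^ 2) := by
            rw [Finset.sum_const, nsmul_eq_mul, hη]
            field_simp
        _ ≤ 1 * (δ / 2 * ‖w‖ ^ 2) := by
            gcongr
            rw [div_le_one (by positivity)]
            linarith
        _ = _ := one_mul _
    have h3 := abs_sub_abs_le_abs_sub (meanDeviation P x t (fun a => w a ^ 2) ω)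
      (meanDeviation P x t (fun a => w (φ a) ^ 2) ω)
    simp only [Function.comp_def] at h1
    linarith
  · change |w a ^ 2 - w (φ a) ^ 2| ≤ _
    rw [sq_sub_sq, abs_mul]
    calc |w a + w (φ a)| * |w a - w (φ a)|
        ≤ (κ * ‖w‖ + κ * ‖w‖) * (‖w‖ * (δ / (8 * κ))) := by
          gcongr
          · exact (abs_add_le _ _).trans (add_le_add (abs_apply_le hκ w _) (abs_apply_le hκ w _))
          · exact (abs_apply_sub_le w _ _).trans (by gcongr; exact hφ a)
      _ = _ := by field_simp; ring

end LawOfLargeNumbers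

/-! ### Existence, uniqueness and the basic inequality for the minimizer. -/

section Minimizer

variable {X : Set Plane} {H : Type*} [NormedAddCommGroup H] [InnerProductSpace ℝ H]
  [RKHS ℝ H X ℝ]

/-- The normal equation cancels the part linear in `w`, leaving a quadratic increment that is
positive definite for `γ > 0`; minimality and uniqueness follow from it. -/
theorem tikhonovFunctional_add {γ : ℝ} {t : ℕ} {x : ℕ → X} {y : ℕ → ℝ} {f : H}
    (hf : ∀ w : H, (∑ i ∈ Finset.range t, y i * w (x i)) / t =
      γ * inner ℝ f w + (∑ i ∈ Finset.range t, f (x i) * w (x i)) / t) (w : H) :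
    tikhonovFunctional γ t x y (f + w) = tikhonovFunctional γ t x y f +
      (∑ i ∈ Finset.range t, w (x i) ^ 2) / t + γ * ‖w‖ ^ 2 := by
  have h1 : ∑ i ∈ Finset.range t, (y i - (f + w) (x i)) ^ 2 =
      ∑ i ∈ Finset.range t, (y i - f (x i)) ^ 2 + ∑ i ∈ Finset.range t, w (x i) ^ 2 -
        2 * (∑ i ∈ Finset.range t, y i * w (x i) - ∑ i ∈ Finset.range t, f (x i) * w (x i)) := by
    rw [← Finset.sum_sub_distrib, Finset.mul_sum, ← Finset.sum_add_distrib,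
      ← Finset.sum_sub_distrib]
    refine Finset.sum_congr rfl fun i _ => ?_
    rw [RKHS.coe_add, Pi.add_apply]
    ring
  rw [tikhonovFunctional, tikhonovFunctional, h1, norm_add_sq_real]
  have := hf w
  linear_combination (-2) * this

variable [CompleteSpace H]

/-- Lax–Milgram: the regularization makes the bilinear form coercive with constant `γ`. -/
theorem exists_tikhonov_normal_equation {γ : ℝ} (hγ : 0 < γ) (t : ℕ) (x : ℕ → X) (y : ℕ → ℝ) :
    ∃ f : H, ∀ w : H, (∑ i ∈ Finset.range t, y i * w (x i)) / t =
      γ * inner ℝ f w + (∑ i ∈ Finset.range t, f (x i) * w (x i)) / t := by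
  let A : H →L[ℝ] H := γ • ContinuousLinearMap.id ℝ H + (t : ℝ)⁻¹ • ∑ i ∈ Finset.range t,
    InnerProductSpace.rankOne ℝ (kernelSection H (x i)) (kernelSection H (x i))
  let B : H →L[ℝ] H →L[ℝ] ℝ :=
    (isBoundedBilinearMap_inner (𝕜 := ℝ) (E := H)).toContinuousLinearMap.comp A
  have hB : ∀ f w : H, B f w =
      γ * inner ℝ f w + (∑ i ∈ Finset.range t, f (x i) * w (x i)) / t := by
    intro f w
    change inner ℝ (A f) w = _
    simp [A, inner_add_left, real_inner_smul_left, sum_inner, kernelSection_inner, div_eq_inv_mul]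
  have hco : IsCoercive B := by
    refine ⟨γ, hγ, fun u => ?_⟩
    rw [hB, real_inner_self_eq_norm_sq]
    have : 0 ≤ (∑ i ∈ Finset.range t, u (x i) * u (x i)) / (t : ℝ) :=
      div_nonneg (Finset.sum_nonneg fun i _ => mul_self_nonneg _) (Nat.cast_nonneg t)
    linarith
  refine ⟨hco.continuousLinearEquivOfBilin.symm
    ((t : ℝ)⁻¹ • ∑ i ∈ Finset.range t, y i • kernelSection H (x i)), fun w => ?_⟩
  rw [← hB, ← hco.continuousLinearEquivOfBilin_apply, ContinuousLinearEquiv.apply_symm_apply]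
  simp [real_inner_smul_left, sum_inner, kernelSection_inner, div_eq_inv_mul]

theorem existsUnique_isMinOn_tikhonovFunctional {γ : ℝ} (hγ : 0 < γ) (t : ℕ) (x : ℕ → X)
    (y : ℕ → ℝ) : ∃! f : H, IsMinOn (tikhonovFunctional γ t x y) univ f := by
  obtain ⟨f, hf⟩ := exists_tikhonov_normal_equation (H := H) hγ t x y
  have hJ := tikhonovFunctional_add hf
  have hS : ∀ w : H, 0 ≤ (∑ i ∈ Finset.range t, w (x i) ^ 2) / (t : ℝ) := fun w =>
    div_nonneg (Finset.sum_nonneg fun i _ => sq_nonneg _) (Nat.cast_nonneg t)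
  refine ⟨f, fun g _ => ?_, fun g hg => ?_⟩
  · have := hJ (g - f)
    rw [add_sub_cancel] at this
    change tikhonovFunctional γ t x y f ≤ tikhonovFunctional γ t x y g
    have := hS (g - f)
    have : 0 ≤ γ * ‖g - f‖ ^ 2 := by positivity
    linarith
  · have h1 := hJ (g - f)
    rw [add_sub_cancel] at h1
    have h2 : tikhonovFunctional γ t x y g ≤ tikhonovFunctional γ t x y f := hg (mem_univ f)
    have h3 := hS (g - f)
    have h4 : ‖g - f‖ ^ 2 ≤ 0 := by
      by_contra! h
      linarith [mul_pos hγ h]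
    have h5 : ‖g - f‖ = 0 := by
      have := sq_nonneg ‖g - f‖
      exact pow_eq_zero_iff two_ne_zero |>.1 (le_antisymm h4 this)
    exact sub_eq_zero.1 (norm_eq_zero.1 h5)

theorem isMinOn_tikhonovEstimate {γ : ℝ} (hγ : 0 < γ) (t : ℕ) (x : ℕ → X) (y : ℕ → ℝ) :
    IsMinOn (tikhonovFunctional γ t x y) univ (tikhonovEstimate H γ t x y) :=
  Classical.epsilon_spec (existsUnique_isMinOn_tikhonovFunctional hγ t x y).exists

/-- The basic inequality for the error `f - μ` of a minimizer `f`. -/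
theorem basic_inequality {γ : ℝ} {t : ℕ} {x : ℕ → X} {ν : ℕ → ℝ} {μ f : H}
    (hf : IsMinOn (tikhonovFunctional γ t x fun i => μ (x i) + ν i) univ f) :
    (∑ i ∈ Finset.range t, (f - μ) (x i) ^ 2) / t + γ * ‖f - μ‖ ^ 2 ≤
      2 * (inner ℝ (∑ i ∈ Finset.range t, ν i • kernelSection H (x i)) (f - μ) / t) -
        2 * γ * inner ℝ μ (f - μ) := by
  have h1 : tikhonovFunctional γ t x (fun i => μ (x i) + ν i) f ≤
      tikhonovFunctional γ t x (fun i => μ (x i) + ν i) μ := hf (mem_univ μ)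
  set d := f - μ with hd
  have hfd : f = μ + d := by rw [hd]; abel
  rw [hfd, tikhonovFunctional, tikhonovFunctional, norm_add_sq_real] at h1
  have h2 : ∑ i ∈ Finset.range t, (μ (x i) + ν i - (μ + d) (x i)) ^ 2 =
      ∑ i ∈ Finset.range t, (μ (x i) + ν i - μ (x i)) ^ 2 + ∑ i ∈ Finset.range t, d (x i) ^ 2 -
        2 * inner ℝ (∑ i ∈ Finset.range t, ν i • kernelSection H (x i)) d := by
    rw [sum_inner, Finset.mul_sum, ← Finset.sum_add_distrib, ← Finset.sum_sub_distrib]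
    refine Finset.sum_congr rfl fun i _ => ?_
    rw [RKHS.coe_add, Pi.add_apply, real_inner_smul_left, kernelSection_inner]
    ring
  rw [h2, sub_div, add_div] at h1
  linear_combination h1

end Minimizer

/-! ### Second moment of the noise in the Hilbert space. -/

section Noise

variable {X : Set Plane} {H : Type*} [NormedAddCommGroup H] [InnerProductSpace ℝ H]
  [CompleteSpace H] [RKHS ℝ H X ℝ] {Ω : Type*} [MeasurableSpace Ω] {P : Measure Ω}
  {x : ℕ → Ω → X} {ν : ℕ → Ω → ℝ} {σ : ℝ≥0}

theorem IsMeasurementNoise.memLp (hν : IsMeasurementNoise P x ν σ) (i : ℕ) : MemLp (ν i) 2 P := by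
  have h : MemLp id 2 (P.map (ν i)) := by
    rw [hν.law i]; exact memLp_id_gaussianReal 2
  simpa using h.comp_of_map (hν.measurable i).aemeasurable

theorem IsMeasurementNoise.integral_eq_zero (hν : IsMeasurementNoise P x ν σ) (i : ℕ) :
    ∫ ω, ν i ω ∂P = 0 := by
  have h := integral_map (μ := P) (hν.measurable i).aemeasurable (f := fun z : ℝ => z)
    aestronglyMeasurable_id
  rw [← h, hν.law i, integral_id_gaussianReal]

theorem IsMeasurementNoise.integral_sq [IsProbabilityMeasure P] (hν : IsMeasurementNoise P x ν σ)
    (i : ℕ) :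
    ∫ ω, ν i ω ^ 2 ∂P = σ ^ 2 := by
  have h := variance_eq_sub (hν.memLp i)
  rw [hν.integral_eq_zero i, ← variance_id_map (hν.measurable i).aemeasurable, hν.law i,
    variance_id_gaussianReal] at h
  simpa using h.symm

theorem measurable_inner_kernelSection (hk : Continuous fun a : X => kernelSection H a)
    (hx : ∀ i, Measurable (x i)) (i j : ℕ) :
    Measurable fun ω => inner ℝ (kernelSection H (x i ω)) (kernelSection H (x j ω)) := by
  have hc : Continuous fun a : X × X => inner ℝ (kernelSection H a.1) (kernelSection H a.2) :=
    (hk.comp continuous_fst).inner (hk.comp continuous_snd)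
  exact hc.measurable.comp (f := fun ω => (x i ω, x j ω)) ((hx i).prodMk (hx j))

theorem abs_inner_kernelSection_le {κ : ℝ} (hκ : ∀ a : X, ‖kernelSection H a‖ ≤ κ) (a b : X) :
    |inner ℝ (kernelSection H a) (kernelSection H b)| ≤ κ ^ 2 := by
  have := norm_nonneg (kernelSection H a)
  refine (abs_real_inner_le_norm _ _).trans ?_
  rw [pow_two]
  exact mul_le_mul (hκ a) (hκ b) (norm_nonneg _) (this.trans (hκ a))

theorem integrable_noise_mul_noise (hk : Continuous fun a : X => kernelSection H a) {κ : ℝ}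
    (hκ : ∀ a : X, ‖kernelSection H a‖ ≤ κ) (hx : ∀ i, Measurable (x i))
    (hν : IsMeasurementNoise P x ν σ) (i j : ℕ) :
    Integrable (fun ω => ν i ω * ν j ω *
      inner ℝ (kernelSection H (x i ω)) (kernelSection H (x j ω))) P :=
  Integrable.mul_bdd (c := κ ^ 2) ((hν.memLp i).integrable_mul (hν.memLp j))
    (measurable_inner_kernelSection hk hx i j).aestronglyMeasurable
    (Eventually.of_forall fun _ => abs_inner_kernelSection_le hκ _ _)

/-- Everything except `ν j` is a function `Φ` of the locations up to `j` and the noises before `j`;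
hence the integral factors through the zero mean of `ν j`. -/
theorem integral_noise_mul_noise_of_lt (hk : Continuous fun a : X => kernelSection H a)
    (hν : IsMeasurementNoise P x ν σ) (hx : ∀ i, Measurable (x i)) {i j : ℕ} (hij : i < j) :
    ∫ ω, ν i ω * ν j ω * inner ℝ (kernelSection H (x i ω)) (kernelSection H (x j ω)) ∂P = 0 := by
  let Φ : (Fin (j + 1) → X) × (Fin j → ℝ) → ℝ := fun z =>
    z.2 ⟨i, hij⟩ * inner ℝ (kernelSection H (z.1 ⟨i, by omega⟩)) (kernelSection H (z.1 (Fin.last j)))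
  have hc : Continuous fun a : X × X => inner ℝ (kernelSection H a.1) (kernelSection H a.2) :=
    (hk.comp continuous_fst).inner (hk.comp continuous_snd)
  have hΦ : Measurable Φ := by
    refine Measurable.mul (by fun_prop) ?_
    exact hc.measurable.comp (f := fun z : (Fin (j + 1) → X) × (Fin j → ℝ) =>
      (z.1 ⟨i, by omega⟩, z.1 (Fin.last j))) (by fun_prop)
  have hind := (hν.indep j).comp measurable_id hΦ
  have hpast : Measurable fun ω => ((fun l : Fin (j + 1) => x l ω), (fun l : Fin j => ν l ω)) :=
    (measurable_pi_iff.2 fun l : Fin (j + 1) => hx l).prodMk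
      (measurable_pi_iff.2 fun l : Fin j => hν.measurable l)
  have h := hind.integral_mul_eq_mul_integral (hν.measurable j).aestronglyMeasurable
    (hΦ.comp hpast).aestronglyMeasurable
  have h0 : P[id ∘ ν j] = 0 := hν.integral_eq_zero j
  rw [h0, zero_mul] at h
  rw [← h]
  refine integral_congr_ae (Eventually.of_forall fun ω => ?_)
  simp only [Pi.mul_apply, Function.comp_apply, id, Φ, Fin.val_last]
  ring

theorem integral_noise_mul_noise_of_ne (hk : Continuous fun a : X => kernelSection H a)
    (hν : IsMeasurementNoise P x ν σ) (hx : ∀ i, Measurable (x i)) {i j : ℕ} (hij : i ≠ j) :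
    ∫ ω, ν i ω * ν j ω * inner ℝ (kernelSection H (x i ω)) (kernelSection H (x j ω)) ∂P = 0 := by
  rcases hij.lt_or_gt with h | h
  · exact integral_noise_mul_noise_of_lt hk hν hx h
  · simp_rw [mul_comm (ν i _), real_inner_comm (kernelSection H (x j _))]
    exact integral_noise_mul_noise_of_lt hk hν hx h

/-- Expanding the square leaves only the `t` diagonal terms, so the growth is linear in `t`. -/
theorem integral_norm_noise_sq_le [IsProbabilityMeasure P]
    (hk : Continuous fun a : X => kernelSection H a) {κ : ℝ}
    (hκ : ∀ a : X, ‖kernelSection H a‖ ≤ κ) (hx : ∀ i, Measurable (x i))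
    (hν : IsMeasurementNoise P x ν σ) (t : ℕ) :
    Integrable (fun ω => ‖∑ i ∈ Finset.range t, ν i ω • kernelSection H (x i ω)‖ ^ 2) P ∧
    ∫ ω, ‖∑ i ∈ Finset.range t, ν i ω • kernelSection H (x i ω)‖ ^ 2 ∂P ≤ t * (σ ^ 2 * κ ^ 2) := by
  have hint := integrable_noise_mul_noise hk hκ hx hν
  have e : (fun ω => ‖∑ i ∈ Finset.range t, ν i ω • kernelSection H (x i ω)‖ ^ 2) = fun ω =>
      ∑ i ∈ Finset.range t, ∑ j ∈ Finset.range t, ν i ω * ν j ω *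
        inner ℝ (kernelSection H (x i ω)) (kernelSection H (x j ω)) := by
    ext ω
    rw [← real_inner_self_eq_norm_sq, sum_inner]
    simp only [inner_sum, real_inner_smul_left, real_inner_smul_right]
    exact Finset.sum_congr rfl fun i _ => Finset.sum_congr rfl fun j _ => by ring
  rw [e]
  refine ⟨integrable_finsetSum _ fun i _ => integrable_finsetSum _ fun j _ => hint i j, ?_⟩
  rw [integral_finsetSum _ fun i _ => integrable_finsetSum _ fun j _ => hint i j]
  rw [← nsmul_eq_mul, ← Finset.card_range t, ← Finset.sum_const, Finset.card_range]
  refine Finset.sum_le_sum fun i hi => ?_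
  rw [integral_finsetSum _ fun j _ => hint i j, Finset.sum_eq_single i
    (fun j _ hj => integral_noise_mul_noise_of_ne hk hν hx hj.symm) (fun h => absurd hi h),
    ← hν.integral_sq i, ← integral_mul_const]
  refine integral_mono (hint i i) ((hν.memLp i).integrable_sq.mul_const _) fun ω => ?_
  simp only [← pow_two]
  exact mul_le_mul_of_nonneg_left
    ((le_abs_self _).trans (abs_inner_kernelSection_le hκ _ _)) (sq_nonneg _)

theorem measure_le_norm_noise_le [IsProbabilityMeasure P]
    (hk : Continuous fun a : X => kernelSection H a) {κ : ℝ}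
    (hκ : ∀ a : X, ‖kernelSection H a‖ ≤ κ) (hx : ∀ i, Measurable (x i))
    (hν : IsMeasurementNoise P x ν σ) (t : ℕ) {c : ℝ} (hc : 0 < c) :
    P {ω | c ≤ ‖∑ i ∈ Finset.range t, ν i ω • kernelSection H (x i ω)‖} ≤
      ENNReal.ofReal (t * (σ ^ 2 * κ ^ 2) / c ^ 2) := by
  obtain ⟨hi, hle⟩ := integral_norm_noise_sq_le hk hκ hx hν t
  have h := mul_meas_ge_le_integral_of_nonneg (Eventually.of_forall fun ω => sq_nonneg _) hi (c ^ 2)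
  have h2 : P.real {ω | c ≤ ‖∑ i ∈ Finset.range t, ν i ω • kernelSection H (x i ω)‖} ≤
      t * (σ ^ 2 * κ ^ 2) / c ^ 2 := by
    rw [le_div_iff₀' (by positivity)]
    exact (mul_le_mul_of_nonneg_left (measureReal_mono fun ω hω =>
      pow_le_pow_left₀ hc.le hω 2) (by positivity)).trans (h.trans hle)
  rw [← ofReal_measureReal]
  exact ENNReal.ofReal_le_ofReal h2

end Noise

/-! ### Convergence in probability in the Hilbert norm. -/

section Consistency

theorem exists_pos_rpow_mul_le {θ : ℝ} (hθ : 0 < θ) (B : ℝ) {ε : ℝ} (hε : 0 < ε) :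
    ∃ s : ℝ, 0 < s ∧ s ^ θ * B ≤ ε := by
  have h : Tendsto (fun s : ℝ => s ^ θ * B) (𝓝[>] 0) (𝓝 0) := by
    have := ((Real.continuousAt_rpow_const 0 θ (Or.inr hθ.le)).tendsto.mul_const B).mono_left
      (nhdsWithin_le_nhds (s := Ioi 0))
    simpa [Real.zero_rpow hθ.ne'] using this
  obtain ⟨s, hs, hs0⟩ := ((h.eventually (gt_mem_nhds hε)).and self_mem_nhdsWithin).exists
  exact ⟨s, hs0, hs.le⟩

variable {X : Set Plane} {H : Type*} [NormedAddCommGroup H] [InnerProductSpace ℝ H]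
  [CompleteSpace H] [RKHS ℝ H X ℝ] {Ω : Type*} [MeasurableSpace Ω] {P : Measure Ω}
  [IsProbabilityMeasure P] {x : ℕ → Ω → X}

omit [IsProbabilityMeasure P] in
/-- The error is small where the noise average and the deviation of the empirical second moments
from their expectations are. -/
theorem norm_error_lt {γ : ℝ} {t : ℕ} (ht : 0 < t) {ν : ℕ → Ω → ℝ} {μ f : H} {ω : Ω} {B θ : ℝ}
    (hμ : ∀ s : ℝ, 0 < s → ∀ (w : H) (i : ℕ),
      2 * inner ℝ μ w ≤ ‖w‖ ^ 2 + (∫ ω, w (x i ω) ^ 2 ∂P) / s + s ^ θ * B)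
    (hf : IsMinOn (tikhonovFunctional γ t (fun i => x i ω) fun i => μ (x i ω) + ν i ω) univ f)
    {ε s : ℝ} (hε : 0 < ε) (hs : 0 < s) (hsε : s ^ θ * B ≤ ε ^ 2 / 32)
    (hγ : 0 < γ) (hγs : γ ≤ 2 * s)
    (hnoise : ‖∑ i ∈ Finset.range t, ν i ω • kernelSection H (x i ω)‖ ≤ ε / 32 * γ * t)
    (hdev : ∀ w : H, |meanDeviation P x t (fun a => w a ^ 2) ω| ≤ s / 2 * ‖w‖ ^ 2) :
    ‖f - μ‖ < ε := by
  have hb := basic_inequality hf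
  set d := f - μ
  have ht0 : (0 : ℝ) < t := by exact_mod_cast ht
  set S := (∑ i ∈ Finset.range t, d (x i ω) ^ 2) / (t : ℝ) with hS
  set D := (∑ i ∈ Finset.range t, ∫ ω', d (x i ω') ^ 2 ∂P) / (t : ℝ) with hD
  have hS0 : 0 ≤ S := div_nonneg (Finset.sum_nonneg fun i _ => sq_nonneg _) ht0.le
  have hDS : D ≤ S + s / 2 * ‖d‖ ^ 2 := by
    have := (abs_le.1 (hdev d)).1
    simp only [meanDeviation] at this
    linarith
  have hN : inner ℝ (∑ i ∈ Finset.range t, ν i ω • kernelSection H (x i ω)) d / (t : ℝ) ≤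
      ε / 32 * γ * ‖d‖ := by
    rw [div_le_iff₀ ht0]
    calc _ ≤ _ := real_inner_le_norm _ _
      _ ≤ ε / 32 * γ * t * ‖d‖ := by gcongr
      _ = _ := by ring
  have hsrc : -2 * inner ℝ μ d ≤ ‖d‖ ^ 2 / 2 + D / (2 * s) + 2 * (s ^ θ * B) := by
    have h1 : ∀ i ∈ Finset.range t, -inner ℝ μ d ≤
        ‖d‖ ^ 2 / 4 + (∫ ω', d (x i ω') ^ 2 ∂P) / (4 * s) + s ^ θ * B := by
      intro i _
      -- The factor `1/2` leaves `‖d‖²/2` after doubling; with the `‖d‖²/4` from `hDs`, the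
      -- coefficient stays below the `1` available on the left.
      have := hμ s hs ((-(1 / 2) : ℝ) • d) i
      simp only [RKHS.coe_smul, Pi.smul_apply, smul_eq_mul, mul_pow, integral_const_mul,
        real_inner_smul_right, norm_smul, norm_neg, Real.norm_eq_abs] at this
      rw [abs_of_pos (by norm_num)] at this
      calc -inner ℝ μ d = 2 * (-(1 / 2) * inner ℝ μ d) := by ring
        _ ≤ _ := this
        _ = _ := by field_simp; ring
    have h2 := Finset.sum_le_sum h1
    simp only [Finset.sum_add_distrib, Finset.sum_const, Finset.card_range, nsmul_eq_mul,
      ← Finset.sum_div] at h2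
    have h3 : (∑ i ∈ Finset.range t, ∫ ω', d (x i ω') ^ 2 ∂P) = t * D := by
      rw [hD]; field_simp
    rw [h3] at h2
    have h4 : -inner ℝ μ d ≤ ‖d‖ ^ 2 / 4 + D / (4 * s) + s ^ θ * B := by
      refine le_of_mul_le_mul_left (h2.trans_eq ?_) ht0
      ring
    have h5 : D / (2 * s) = 2 * (D / (4 * s)) := by field_simp; ring
    linarith
  -- `γ ≤ 2s` allows the empirical moment to be charged to the term `S / γ` of the basic inequality.
  have hDs : D / (2 * s) ≤ S / γ + ‖d‖ ^ 2 / 4 := by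
    calc D / (2 * s) ≤ (S + s / 2 * ‖d‖ ^ 2) / (2 * s) := by gcongr
      _ = S / (2 * s) + ‖d‖ ^ 2 / 4 := by field_simp; ring
      _ ≤ _ := by gcongr
  have hmain : ‖d‖ ^ 2 / 4 ≤ ε / 16 * ‖d‖ + 2 * (s ^ θ * B) := by
    have h1 : S / γ + ‖d‖ ^ 2 ≤ ε / 16 * ‖d‖ - 2 * inner ℝ μ d := by
      refine le_of_mul_le_mul_left ?_ hγ
      have : γ * (S / γ) = S := by field_simp
      rw [mul_add, this]
      linarith
    linarith
  by_contra! hεd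
  -- If `‖d‖ ≥ ε`, then `hmain` and `hsε` give `‖d‖²/4 ≤ ‖d‖²/16 + ‖d‖²/16`, which is impossible.
  nlinarith

/-- The estimates converge in probability to the target in the norm of the Hilbert space. -/
theorem tendsto_measure_le_norm_sub (hX : IsCompact X)
    (hk : Continuous fun a : X => kernelSection H a) {μ : H}
    {𝒟 : Set (X → ℝ)} (h𝒟 : ∀ q ∈ 𝒟, IsNondegenerateDensity q)
    (hx : ∀ i, Measurable (x i)) {ν : ℕ → Ω → ℝ} {σ : ℝ≥0} (hν : IsMeasurementNoise P x ν σ)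
    (hA : CovarianceDecay P 𝒟 x ν) {B θ : ℝ} (hθ : 0 < θ)
    (hμ : ∀ s : ℝ, 0 < s → ∀ (w : H) (i : ℕ),
      2 * inner ℝ μ w ≤ ‖w‖ ^ 2 + (∫ ω, w (x i ω) ^ 2 ∂P) / s + s ^ θ * B)
    {α : ℝ} (hα : 0 < α) (hα' : α < 1 / 2) {c : ℝ} (hc : 0 < c) {γ : ℕ → ℝ}
    (hγ : ∀ t : ℕ, 1 ≤ t → γ t = c * (t : ℝ) ^ (-α)) {f : ℕ → Ω → H}
    (hf : ∀ t : ℕ, 1 ≤ t → ∀ ω, IsMinOn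
      (tikhonovFunctional (γ t) t (fun i => x i ω) fun i => μ (x i ω) + ν i ω) univ (f t ω))
    {ε : ℝ} (hε : 0 < ε) :
    Tendsto (fun t => P {ω | ε ≤ ‖f t ω - μ‖}) atTop (𝓝 0) := by
  have : CompactSpace X := isCompact_iff_compactSpace.1 hX
  obtain ⟨κ, -, hκ⟩ := exists_norm_kernelSection_le hk
  -- `s` depends on `ε` only and is fixed before `t` grows; positivity of `θ`, that is `r > 1/2`,
  -- makes this possible.
  obtain ⟨s, hs, hsε⟩ := exists_pos_rpow_mul_le hθ B (show 0 < ε ^ 2 / 32 by positivity)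
  have hγlim : Tendsto (fun t : ℕ => c * (t : ℝ) ^ (-α)) atTop (𝓝 0) := by
    have := ((tendsto_rpow_neg_atTop hα).comp (tendsto_natCast_atTop_atTop (R := ℝ))).const_mul c
    simpa using this
  have hnoise : Tendsto (fun t : ℕ => ENNReal.ofReal
      (σ ^ 2 * κ ^ 2 / (ε / 32 * c) ^ 2 * (t : ℝ) ^ (-(1 - 2 * α)))) atTop (𝓝 0) := by
    have := ENNReal.tendsto_ofReal (((tendsto_rpow_neg_atTop (show 0 < 1 - 2 * α by linarith)).comp
      (tendsto_natCast_atTop_atTop (R := ℝ))).const_mul (σ ^ 2 * κ ^ 2 / (ε / 32 * c) ^ 2))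
    simpa using this
  have hdev := tendsto_measure_exists_lt_abs_meanDeviation hX hk h𝒟 hx hA (half_pos hs)
  have hsum := hnoise.add hdev
  rw [add_zero] at hsum
  refine tendsto_of_tendsto_of_tendsto_of_le_of_le' tendsto_const_nhds hsum
    (Eventually.of_forall fun _ => zero_le) ?_
  filter_upwards [eventually_ge_atTop 1, hγlim.eventually (gt_mem_nhds (by positivity : 0 < 2 * s))]
    with t ht hγs
  have ht0 : (0 : ℝ) < t := by exact_mod_cast ht
  have hγ0 : 0 < γ t := by
    rw [hγ t ht]; positivity
  have hN := measure_le_norm_noise_le hk hκ hx hν t (show 0 < ε / 32 * γ t * t by positivity)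
  -- Chebyshev's bound is of order `1 / (t γ²)`, and it vanishes because `1 - 2α > 0`.
  have hbound : t * (σ ^ 2 * κ ^ 2) / (ε / 32 * γ t * t) ^ 2 =
      σ ^ 2 * κ ^ 2 / (ε / 32 * c) ^ 2 * (t : ℝ) ^ (-(1 - 2 * α)) := by
    have h1 : (t : ℝ) ^ (-(1 - 2 * α)) = ((t : ℝ) * ((t : ℝ) ^ (-α)) ^ 2)⁻¹ := by
      rw [Real.rpow_neg ht0.le, ← Real.rpow_mul_natCast ht0.le]
      nth_rw 2 [← Real.rpow_one (t : ℝ)]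
      rw [← Real.rpow_add ht0]
      congr 2
      push_cast
      ring
    rw [h1, hγ t ht]
    have : (0 : ℝ) < (t : ℝ) ^ (-α) := by positivity
    field_simp
  rw [hbound] at hN
  refine le_trans ?_ (add_le_add_left hN _)
  refine (measure_mono fun ω hω => ?_).trans (measure_union_le _ _)
  by_contra hcon
  simp only [mem_union, mem_ofPred_eq, not_or, not_le, not_exists, not_lt] at hcon hω
  refine absurd hω (not_le.2 (norm_error_lt ht hμ (hf t ht ω) hε hs hsε hγ0 ?_ hcon.1.le hcon.2))
  rw [hγ t ht]
  exact hγs.le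

end Consistency

end RKHSConsistency

/-! ### The main theorem. -/

theorem proposition4
    -- the compact domain, the Mercer kernel and its reproducing kernel Hilbert space
    {X : Set RKHSConsistency.Plane} (hX : IsCompact X)
    (K : X → X → ℝ) (hK : Continuous (Function.uncurry K))
    {H : Type*} [NormedAddCommGroup H] [InnerProductSpace ℝ H] [CompleteSpace H]
    [RKHS ℝ H X ℝ] (hHK : ∀ a b : X, RKHS.kernel H a b 1 = K a b)
    -- the unknown function
    (μ : H)
    -- locations and noise
    {Ω : Type*} [MeasurableSpace Ω] (P : Measure Ω) [IsProbabilityMeasure P]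
    (𝒟 : Set (X → ℝ)) (h𝒟 : ∀ p ∈ 𝒟, RKHSConsistency.IsNondegenerateDensity p)
    (x : ℕ → Ω → X) (p : ℕ → Ω → X → ℝ) (hx : RKHSConsistency.IsDrawnFrom P 𝒟 x p)
    (ν : ℕ → Ω → ℝ) (σ : ℝ≥0) (hν : RKHSConsistency.IsMeasurementNoise P x ν σ)
    -- the two assumptions
    (hA₁ : RKHSConsistency.CovarianceDecay P 𝒟 x ν)
    (r : ℝ) (hr : 1 / 2 < r) (hr' : r ≤ 1) (hA₂ : RKHSConsistency.SourceCondition K 𝒟 r μ)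
    -- the regularization parameter
    (α : ℝ) (hα : 0 < α) (hα' : α < 1 / 2) (c : ℝ) (hc : 0 < c)
    (γ : ℕ → ℝ) (hγ : ∀ t : ℕ, 1 ≤ t → γ t = c * (t : ℝ) ^ (-α))
    -- measurements and estimates
    (y : ℕ → Ω → ℝ) (hy : ∀ i ω, y i ω = μ (x i ω) + ν i ω)
    (μhat : ℕ → Ω → H)
    (hμhat : ∀ t ω, μhat t ω =
      RKHSConsistency.tikhonovEstimate H (γ t) t (fun i => x i ω) (fun i => y i ω)) :
    -- the minimizer exists and is unique, so that the estimate is well defined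
    (∀ t : ℕ, 1 ≤ t → ∀ ω, ∃! f : H, IsMinOn
      (RKHSConsistency.tikhonovFunctional (γ t) t (fun i => x i ω) (fun i => y i ω)) univ f) ∧
    -- convergence in probability in the RKHS norm
    TendstoInMeasure P μhat atTop (fun _ => μ) ∧
    -- convergence in probability in the sup-norm
    (∀ ε : ℝ≥0∞, 0 < ε →
      Tendsto (fun t => P {ω | ε ≤ ⨆ a : X, ‖μhat t ω a - μ a‖ₑ}) atTop (𝓝 0)) := by
  have hk := RKHSConsistency.continuous_kernelSection hK hHK
  have hγ0 : ∀ t : ℕ, 1 ≤ t → 0 < γ t := fun t ht => by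
    have : (0 : ℝ) < t := by exact_mod_cast ht
    rw [hγ t ht]
    positivity
  obtain ⟨B, hB⟩ := RKHSConsistency.two_inner_le_integral_comp hX hHK hk hx h𝒟 hr hr' hA₂
  -- Nothing is claimed at `t = 0`, where `γ` is unspecified; the limits do not see it.
  have hmin : ∀ t : ℕ, 1 ≤ t → ∀ ω, IsMinOn (RKHSConsistency.tikhonovFunctional (γ t) t
      (fun i => x i ω) fun i => μ (x i ω) + ν i ω) univ (μhat t ω) := fun t ht ω => by
    rw [hμhat]
    simp only [hy]
    exact RKHSConsistency.isMinOn_tikhonovEstimate (hγ0 t ht) _ _ _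
  have hconv : TendstoInMeasure P μhat atTop fun _ => μ := by
    rw [tendstoInMeasure_iff_norm]
    exact fun ε hε => RKHSConsistency.tendsto_measure_le_norm_sub hX hk h𝒟 hx.measurable hν hA₁
      (by linarith) hB hα hα' hc hγ hmin hε
  refine ⟨fun t ht ω => RKHSConsistency.existsUnique_isMinOn_tikhonovFunctional (hγ0 t ht) _ _ _,
    hconv, fun ε hε => ?_⟩
  have : CompactSpace X := isCompact_iff_compactSpace.1 hX
  obtain ⟨κ, hκ1, hκ⟩ := RKHSConsistency.exists_norm_kernelSection_le hk
  have hκ0 : 0 < κ := by linarith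
  -- The sup-norm is at most `κ` times the norm of `H`, so a deviation `ε` of the former forces a
  -- deviation `ε / κ` of the latter.
  refine tendsto_of_tendsto_of_tendsto_of_le_of_le tendsto_const_nhds
    (hconv (ε / ENNReal.ofReal κ) (ENNReal.div_pos hε.ne' ENNReal.ofReal_ne_top))
    (fun _ => zero_le) fun t => measure_mono fun ω hω => ?_
  refine ENNReal.div_le_of_le_mul (le_trans hω (iSup_le fun a => ?_))
  rw [edist_eq_enorm_sub, ← ofReal_norm, ← ofReal_norm, ← ENNReal.ofReal_mul (norm_nonneg _),
    mul_comm]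
  refine ENNReal.ofReal_le_ofReal ?_
  have := RKHSConsistency.abs_apply_le hκ (μhat t ω - μ) a
  rwa [RKHS.coe_sub, Pi.sub_apply] at this
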